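/- Let $m\ge 1$, let $a_1,\dots,a_{2m}$ be positive integers, and let $\frac rs=[a_1,\dots,a_{2m}]=a_1+\cfrac{1}{a_2+\cfrac{1}{\ddots+\cfrac1{a_{2m}}}}$. For a parameter $t$ put $[a]_t=1+t+\dots+t^{a-1}$. The $q$-rational $\left[\frac rs\right]_q\in\mathbb Z(q)$ is $$\left[\frac rs\right]_q=[a_1]_q+\cfrac{q^{a_1}}{[a_2]_{q^{-1}}+\cfrac{q^{-a_2}}{[a_3]_q+\cfrac{q^{a_3}}{[a_4]_{q^{-1}}+\cfrac{q^{-a_4}}{\ddots+\cfrac{q^{a_{2m-1}}}{[a_{2m}]_{q^{-1}}}}}}},$$ and we write it in lowest terms as $\left[\frac rs\right]_q=\frac{\mathcal R(q)}{\mathcal S(q)}$, with $\mathcal R,\mathcal S\in\mathbb Z[q]$ coprime and the leading coefficient of $\mathcal S$ positive. Let $G=G(r/s)$ be the snake graph of unit square tiles in which the step from each tile to the next goes right ($R$) or up ($U$) according to the word $R^{a_1-1}U^{a_2}R^{a_3}U^{a_4}\cdots R^{a_{2m-1}}U^{a_{2m}-1}$. Place $G$ so that the top left corner of its bounding box is the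 top left corner of Young diagrams (drawn with left-aligned rows, the longest row on top). Let $\lambda=\lambda(r/s)$ be the partition whose Young diagram has the same bottom boundary as $G$, so that $G$ is the set of boxes of $\lambda$ adjacent to its bottom boundary (along an edge or at a corner), and let $\mu=\mu(r/s)$ be the partition such that $G$ is the skew Young diagram $\lambda/\mu$. Partitions are ordered by inclusion of Young diagrams, and $|\mu|$ is the number of boxes of $\mu$. Let $n=\sum_{i=1}^{2m}a_i$ and $k=\sum_{i=1}^{m}a_{2i}$, and let $\mathrm{Gr}_k(n)$ be the set of $k$-dimensional subspaces of $\mathbb F_q^n$. For a partition $\nu=(\nu_1\ge\dots\ge\nu_k\ge 0)$ inside the $k\times(n-k)$ rectangle, let $I_\nu=\{\,i+(n-k)-\nu_i : 1\le i\le k\,\}$, the set of labels of the vertical steps when the bottom boundary of $\nu$ is walked from the top right to the bottom left corner of the rectangle and its steps are labelled $1,\dots,n$. The open Schubert cell $\Omega^\circ_\nu\subseteq\mathrm{Gr}_k(n)$ is the set of subspaces that are the row space of a $k\times n$ matrix in reduced row echelon form with pivot columns $I_\nu$. Then for every finite field $\mathbb F_q$ with $q$ elements, $$q^{|\mu|}\cdot\mathcal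 R(q)=\left|\bigcup_{\mu\le\nu\le\lambda}\Omega^\circ_\nu\right|.$$ -/

import Mathlib

namespace QSnake

/-! ### Continued fractions and their `q`-deformation -/

/-- The value of the finite continued fraction `[a₁, …, aₗ] = a₁ + 1 / (a₂ + 1 / (⋯ + 1 / aₗ))`. -/
def contFracValue : List ℕ → ℚ
  | [] => 0
  | [a] => a
  | a :: b :: l => a + 1 / contFracValue (b :: l)

/-- The `t`-integer `[a]_t = 1 + t + ⋯ + t ^ (a - 1)`. -/
def qInt {F : Type*} [Field F] (t : F) (a : ℕ) : F :=
  ∑ i ∈ Finset.range a, t ^ i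

/-- The `t`-deformed continued fraction
`[a₁]_t + t^a₁ / ([a₂]_{t⁻¹} + t^(-a₂) / ([a₃]_t + t^a₃ / ([a₄]_{t⁻¹} + ⋯)))`:
the parameter alternates between `t` and `t⁻¹`. -/
def qContFrac {F : Type*} [Field F] : F → List ℕ → F
  | _, [] => 0
  | t, [a] => qInt t a
  | t, a :: b :: l => qInt t a + t ^ a / qContFrac t⁻¹ (b :: l)

/-- The `q`-rational `[r/s]_q`, an element of the field `ℤ(q)`, for `r/s = [a₁, …, a_{2m}]`. -/
noncomputable def qRational (a : List ℕ) : RatFunc ℤ :=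
  qContFrac RatFunc.X a

/-- The sum `a₂ + a₄ + ⋯ + a_{2m}` of the entries in even position. -/
def evenSum : List ℕ → ℕ
  | _ :: b :: l => b + evenSum l
  | _ => 0

/-! ### Snake graphs -/

/-- A step from one tile of a snake graph to the next: right or up. -/
inductive Step
  | R
  | U
  deriving DecidableEq

/-- The word `R^a₁ U^a₂ R^a₃ U^a₄ ⋯ R^a_{2m-1} U^a_{2m}`. -/
def fullWord : List ℕ → List Step
  | a :: b :: l => List.replicate a Step.R ++ (List.replicate b Step.U ++ fullWord l)
  | _ => []

/-- The word `R^(a₁ - 1) U^a₂ R^a₃ ⋯ R^a_{2m-1} U^(a_{2m} - 1)` of the snake graph of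
`[a₁, …, a_{2m}]` (all `aᵢ` positive): the first and the last letter of `fullWord` are removed. -/
def snakeWord (a : List ℕ) : List Step :=
  (fullWord a).tail.dropLast

/-- The tiles of the snake graph with word `w`.  A tile is recorded as `(row, column)`, where rows
are counted from the top and columns from the left of the bounding box of the graph, both from `0`
(the convention of `YoungDiagram`).  So the first tile lies in column `0` and in the row whose
index is the number of letters `U` of `w`; the other tiles form the snake graph of the remaining
word, moved one column to the right if the first letter is `R`. -/
def snakeTiles : List Step → Finset (ℕ × ℕ)
  | [] => {(0, 0)}
  | Step.R :: w => insert (w.count Step.U, 0) ((snakeTiles w).image fun c => (c.1, c.2 + 1))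
  | Step.U :: w => insert (w.count Step.U + 1, 0) (snakeTiles w)

/-- The partition `λ(G)` of the snake graph `G` with word `w`: the Young diagram having the same
bottom boundary as `G`, that is, all boxes weakly above and to the left of a tile of `G`. -/
def outerShape (w : List Step) : YoungDiagram where
  cells := (snakeTiles w).biUnion fun c => Finset.Iic c
  isLowerSet := by
    intro c d hdc hc
    simp only [Finset.coe_biUnion, Set.mem_iUnion, Finset.coe_Iic, Set.mem_Iic] at hc ⊢
    obtain ⟨e, he, hce⟩ := hc
    exact ⟨e, he, hdc.trans hce⟩

theorem mem_outerShape {w : List Step} {i j : ℕ} :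
    (i, j) ∈ outerShape w ↔ ∃ e ∈ snakeTiles w, i ≤ e.1 ∧ j ≤ e.2 := by
  rw [← YoungDiagram.mem_cells]
  simp [outerShape, Prod.le_def]

theorem snakeTiles_row_le (w : List Step) : ∀ e ∈ snakeTiles w, e.1 ≤ w.count Step.U := by
  induction w with
  | nil => simp [snakeTiles]
  | cons s w ih =>
    cases s
    · intro e he
      simp only [snakeTiles, Finset.mem_insert, Finset.mem_image] at he
      rcases he with rfl | ⟨c, hc, rfl⟩
      · simp
      · simpa using ih c hc
    · intro e he
      simp only [snakeTiles, Finset.mem_insert] at he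
      rcases he with rfl | he
      · simp
      · have := ih e he
        simp only [List.count_cons_self]
        omega

theorem snakeTiles_first_mem (w : List Step) : (w.count Step.U, 0) ∈ snakeTiles w := by
  rcases w with _ | ⟨_ | _, w⟩ <;> simp [snakeTiles]

/-- `G` is the set of boxes of `λ(G)` adjacent to the bottom boundary of `λ(G)` (at an edge or at
a corner), that is, the boxes whose diagonal successor is not a box of `λ(G)`. -/
theorem mem_snakeTiles_iff (w : List Step) (i j : ℕ) :
    (i, j) ∈ snakeTiles w ↔ (i, j) ∈ outerShape w ∧ (i + 1, j + 1) ∉ outerShape w := by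
  induction w generalizing i j with
  | nil =>
    simp only [mem_outerShape, snakeTiles, Finset.mem_singleton, Prod.mk.injEq]
    constructor
    · rintro ⟨rfl, rfl⟩
      simp
    · rintro ⟨⟨e, rfl, h1, h2⟩, -⟩
      simp only at h1 h2
      omega
  | cons s w ih =>
    have hf := snakeTiles_first_mem w
    have hr := snakeTiles_row_le w
    cases s
    · have key : ∀ i j, (i, j) ∈ outerShape (Step.R :: w) ↔
          (i ≤ w.count Step.U ∧ j = 0) ∨ ∃ j', j = j' + 1 ∧ (i, j') ∈ outerShape w := by
        intro i j
        simp only [mem_outerShape, snakeTiles, Finset.mem_insert, Finset.mem_image]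
        constructor
        · rintro ⟨e, rfl | ⟨c, hc, rfl⟩, h1, h2⟩
          · left; simp only at h1 h2; omega
          · simp only at h1 h2
            rcases j with _ | j
            · left; exact ⟨h1.trans (hr c hc), rfl⟩
            · right; exact ⟨j, rfl, c, hc, h1, by omega⟩
        · rintro (⟨h1, rfl⟩ | ⟨j', rfl, c, hc, h1, h2⟩)
          · exact ⟨_, Or.inl rfl, h1, le_rfl⟩
          · exact ⟨_, Or.inr ⟨c, hc, rfl⟩, h1, by simpa using h2⟩
      rw [key, key]
      simp only [snakeTiles, Finset.mem_insert, Finset.mem_image, Prod.mk.injEq, Prod.exists]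
      rcases j with _ | j
      · have h0 : (i + 1, 0) ∈ outerShape w ↔ i + 1 ≤ w.count Step.U := by
          rw [mem_outerShape]
          exact ⟨fun ⟨e, he, h1, _⟩ => h1.trans (hr e he), fun h => ⟨_, hf, h, le_rfl⟩⟩
        simp [h0]
        omega
      · simp [ih]
    · have key : ∀ i j, (i, j) ∈ outerShape (Step.U :: w) ↔
          (i ≤ w.count Step.U + 1 ∧ j = 0) ∨ (i, j) ∈ outerShape w := by
        intro i j
        simp only [mem_outerShape, snakeTiles, Finset.mem_insert]
        constructor
        · rintro ⟨e, rfl | he, h1, h2⟩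
          · left; simp only at h1 h2; omega
          · right; exact ⟨e, he, h1, h2⟩
        · rintro (⟨h1, rfl⟩ | ⟨c, hc, h1, h2⟩)
          · exact ⟨_, Or.inl rfl, h1, le_rfl⟩
          · exact ⟨c, Or.inr hc, h1, h2⟩
      rw [key, key]
      simp only [snakeTiles, Finset.mem_insert, Prod.mk.injEq, ih]
      have hb : ∀ i j, (i, j) ∈ outerShape w → i ≤ w.count Step.U := fun i j h => by
        obtain ⟨e, he, h1, _⟩ := mem_outerShape.1 h
        exact h1.trans (hr e he)
      have h0 : i ≤ w.count Step.U → (i, 0) ∈ outerShape w := fun h =>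
        mem_outerShape.2 ⟨_, hf, h, le_rfl⟩
      have h1 := hb (i + 1) (j + 1)
      constructor
      · rintro (⟨rfl, rfl⟩ | ⟨h2, h3⟩)
        · refine ⟨Or.inl ⟨le_rfl, rfl⟩, ?_⟩
          rintro (h | h)
          · omega
          · have := h1 h; omega
        · refine ⟨Or.inr h2, ?_⟩
          rintro (h | h)
          · omega
          · exact h3 h
      · rintro ⟨⟨h2, rfl⟩ | h2, h3⟩
        · by_cases hi : i ≤ w.count Step.U
          · exact Or.inr ⟨h0 hi, fun h => h3 (Or.inr h)⟩
          · left; omega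
        · exact Or.inr ⟨h2, fun h => h3 (Or.inr h)⟩

/-- The partition `μ(G)` of the snake graph `G` with word `w`: it consists of the boxes of `λ(G)`
that are not tiles of `G`, so that `G` is the skew Young diagram of shape `λ(G)/μ(G)`. -/
def innerShape (w : List Step) : YoungDiagram where
  cells := (outerShape w).cells \ snakeTiles w
  isLowerSet := by
    rintro ⟨i, j⟩ ⟨i', j'⟩ hdc hc
    simp only [Finset.coe_sdiff, Set.mem_sdiff, Finset.mem_coe, YoungDiagram.mem_cells,
      mem_snakeTiles_iff, not_and, not_not] at hc ⊢
    have h1 : i' ≤ i := hdc.1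
    have h2 : j' ≤ j := hdc.2
    exact ⟨(outerShape w).up_left_mem h1 h2 hc.1, fun _ =>
      (outerShape w).up_left_mem (by omega) (by omega) (hc.2 hc.1)⟩

/-! ### Schubert cells -/

/-- The Grassmannian `Gr_k(n)` of `k`-dimensional subspaces of `K^n`. -/
abbrev Gr (K : Type*) [Field K] (k n : ℕ) : Type _ :=
  {V : Submodule K (Fin n → K) // Module.finrank K V = k}

/-- The elements of the set `I_ν`, listed increasingly, for a partition `ν` inside the
`k × (n - k)` rectangle.  The bottom boundary of `ν` is walked backwards, from the top right to the
bottom left corner of the rectangle, and its steps are labelled `0, …, n - 1`; the vertical step in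
row `i` (rows being counted from `0`) comes after `i` vertical steps and `n - k - νᵢ` horizontal
ones. -/
def pivot (k n : ℕ) (ν : YoungDiagram) (i : Fin k) : ℕ :=
  i + (n - k - ν.rowLen i)

/-- The `k × n` matrix `M` is in reduced row echelon form with the pivot of row `i` in column
`p i`: each row vanishes to the left of its pivot, and the pivot columns form an identity matrix. -/
def IsEchelon {K : Type*} [Field K] {k n : ℕ} (p : Fin k → ℕ) (M : Matrix (Fin k) (Fin n) K) :
    Prop :=
  (∀ (i : Fin k) (j : Fin n), (j : ℕ) < p i → M i j = 0) ∧
    ∀ (i i' : Fin k) (j : Fin n), (j : ℕ) = p i' → M i j = if i = i' then 1 else 0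

/-- The open Schubert cell `Ω°_ν` in `Gr_k(n)`, for a partition `ν` inside the `k × (n - k)`
rectangle: the subspaces which are the row space of a matrix in reduced row echelon form with
pivot columns `I_ν`. -/
def openSchubertCell (K : Type*) [Field K] (k n : ℕ) (ν : YoungDiagram) : Set (Gr K k n) :=
  {V | ∃ M : Matrix (Fin k) (Fin n) K, IsEchelon (pivot k n ν) M ∧
    (V : Submodule K (Fin n → K)) = Submodule.span K (Set.range M.row)}

end QSnake

/-! Both sides equal the sum of `q ^ |ν|` over `μ ≤ ν ≤ λ`. For the point count, uniqueness of the
reduced echelon form makes the Schubert cells disjoint, and row `i` of an echelon matrix has `ν_i`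
free entries, so the cell of `ν` has `q ^ |ν|` points (`ncard_iUnion_openSchubertCell`).

On the other side, `ν ↦ ν \ μ` identifies the interval with the order ideals of tiles of `G`, so
`R(q)` must be their generating function by size. Split the ideals by whether they contain the first
tile, and write the two parts as `t * N` and `D`. A new letter `R` puts a minimal tile below the old
first tile, a new letter `U` a maximal tile above it; this gives the linear recursion of `wordPair`
(`sum_tileIdeals_filter`).

The same recursion computes the `q`-continued fraction. A letter `R` acts on `x = N / D` by `x ↦ t *
x + 1`, and a letter `U` acts on `1 / x` by `y ↦ 1 + y / t`, whence the alternation of `t` and `t⁻¹`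
(`qContFrac_eq_wordPair`). The initial `R` missing from the snake word turns `N / D` into `(t * N +
D) / D`, whose numerator counts all ideals. This fraction is already reduced (`wordPair_isCoprime`),
so its numerator is `R(q)`. -/

namespace QSnake

open Polynomial

/-! ### The numerator and denominator attached to a word -/

/-- The pair `(N, D)` attached to a word: it is `(1, 1)` for the empty word, and prepending a letter
transforms `N / D` into `t * N / D + 1` (for `R`) or into `t * N / (t * N + D)` (for `U`). -/
def wordPair {A : Type*} [CommSemiring A] (t : A) : List Step → A × A
  | [] => (1, 1)
  | Step.R :: w => (t * (wordPair t w).1 + (wordPair t w).2, (wordPair t w).2)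
  | Step.U :: w => (t * (wordPair t w).1, t * (wordPair t w).1 + (wordPair t w).2)

theorem map_wordPair {A B : Type*} [CommSemiring A] [CommSemiring B] (f : A →+* B) (t : A)
    (w : List Step) :
    wordPair (f t) w = (f (wordPair t w).1, f (wordPair t w).2) := by
  induction w with
  | nil => simp [wordPair]
  | cons s w ih => cases s <;> simp [wordPair, ih]

theorem wordPair_pos (w : List Step) :
    0 < (wordPair (1 : ℤ) w).1 ∧ 0 < (wordPair (1 : ℤ) w).2 := by
  induction w with
  | nil => simp [wordPair]
  | cons s w ih => cases s <;> simp only [wordPair] <;> constructor <;> linarith [ih.1, ih.2]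

/-- At `X = 1` both polynomials take positive values. -/
theorem wordPair_X_ne_zero (w : List Step) :
    (wordPair (X : ℤ[X]) w).1 ≠ 0 ∧ (wordPair (X : ℤ[X]) w).2 ≠ 0 := by
  have h := map_wordPair (evalRingHom (1 : ℤ)) X w
  have hp := wordPair_pos w
  simp only [coe_evalRingHom, eval_X] at h
  rw [h] at hp
  constructor
  · intro h0
    simp [h0] at hp
  · intro h0
    simp [h0] at hp

theorem wordPair_ratFunc (w : List Step) :
    wordPair (RatFunc.X : RatFunc ℤ) w =
      (algebraMap ℤ[X] (RatFunc ℤ) (wordPair X w).1,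
        algebraMap ℤ[X] (RatFunc ℤ) (wordPair X w).2) := by
  rw [← RatFunc.algebraMap_X]
  exact map_wordPair (algebraMap ℤ[X] (RatFunc ℤ)) X w

theorem wordPair_ratFunc_ne_zero (w : List Step) :
    (wordPair (RatFunc.X : RatFunc ℤ) w).1 ≠ 0 ∧ (wordPair (RatFunc.X : RatFunc ℤ) w).2 ≠ 0 := by
  rw [wordPair_ratFunc]
  exact ⟨RatFunc.algebraMap_ne_zero (wordPair_X_ne_zero w).1,
    RatFunc.algebraMap_ne_zero (wordPair_X_ne_zero w).2⟩

/-- The recursion replaces `N` by `X * N` before adding, so the induction must also carry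
coprimality of `X` and `D`. -/
theorem wordPair_isCoprime (w : List Step) :
    IsCoprime (wordPair (X : ℤ[X]) w).1 (wordPair (X : ℤ[X]) w).2 ∧
      IsCoprime (X : ℤ[X]) (wordPair (X : ℤ[X]) w).2 := by
  induction w with
  | nil => simp [wordPair, isCoprime_one_right]
  | cons s w ih =>
    have h : IsCoprime (X * (wordPair (X : ℤ[X]) w).1) (wordPair (X : ℤ[X]) w).2 :=
      ih.2.mul_left ih.1
    cases s <;> simp only [wordPair]
    · refine ⟨?_, ih.2⟩
      simpa using h.add_mul_right_left 1
    · constructor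
      · simpa [add_comm] using h.add_mul_left_right 1
      · simpa [add_comm] using ih.2.add_mul_left_right (wordPair (X : ℤ[X]) w).1

/-- Serves to fix the sign of the leading coefficient of the denominator. -/
theorem wordPair_coeff_nonneg (w : List Step) (n : ℕ) :
    0 ≤ (wordPair (X : ℤ[X]) w).1.coeff n ∧ 0 ≤ (wordPair (X : ℤ[X]) w).2.coeff n := by
  induction w generalizing n with
  | nil =>
    simp only [wordPair, coeff_one]
    split_ifs <;> simp
  | cons s w ih =>
    have h : 0 ≤ (X * (wordPair (X : ℤ[X]) w).1).coeff n := by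
      rcases n with _ | n
      · simp
      · simpa using (ih n).1
    cases s <;> simp only [wordPair, coeff_add]
    · exact ⟨add_nonneg h (ih n).2, (ih n).2⟩
    · exact ⟨h, add_nonneg h (ih n).2⟩

theorem wordPair_leadingCoeff_pos (w : List Step) :
    0 < (wordPair (X : ℤ[X]) w).2.leadingCoeff :=
  lt_of_le_of_ne (wordPair_coeff_nonneg w _).2
    (leadingCoeff_ne_zero.2 (wordPair_X_ne_zero w).2).symm

/-! ### The `q`-continued fraction in lowest terms -/

theorem qInt_succ {F : Type*} [Field F] (t : F) (a : ℕ) : qInt t (a + 1) = 1 + t * qInt t a := by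
  simp [qInt, Finset.sum_range_succ', Finset.mul_sum, pow_succ', add_comm]

theorem wordPair_replicate_R {F : Type*} [Field F] {t : F}
    (h : ∀ w, (wordPair t w).1 ≠ 0 ∧ (wordPair t w).2 ≠ 0) (a : ℕ) (w : List Step) :
    (wordPair t (List.replicate a Step.R ++ w)).1 / (wordPair t (List.replicate a Step.R ++ w)).2 =
      qInt t a + t ^ a * ((wordPair t w).1 / (wordPair t w).2) := by
  induction a with
  | zero => simp [qInt]
  | succ a ih =>
    rw [List.replicate_succ, List.cons_append, wordPair, qInt_succ, pow_succ', add_div,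
      mul_div_assoc, ih, div_self (h _).2]
    ring

/-- Stated for `D / N`, on which `U` acts by the affine map `y ↦ 1 + t⁻¹ * y`; iterating it yields a
`t⁻¹`-integer. -/
theorem wordPair_replicate_U {F : Type*} [Field F] {t : F} (ht : t ≠ 0)
    (h : ∀ w, (wordPair t w).1 ≠ 0 ∧ (wordPair t w).2 ≠ 0) (b : ℕ) (w : List Step) :
    (wordPair t (List.replicate b Step.U ++ w)).2 / (wordPair t (List.replicate b Step.U ++ w)).1 =
      qInt t⁻¹ b + t⁻¹ ^ b * ((wordPair t w).2 / (wordPair t w).1) := by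
  induction b with
  | zero => simp [qInt]
  | succ b ih =>
    have h1 := (h (List.replicate b Step.U ++ w)).1
    rw [List.replicate_succ, List.cons_append, wordPair, qInt_succ, pow_succ', add_div,
      div_self (mul_ne_zero ht h1), mul_comm t, ← div_div, ih]
    field_simp
    ring

theorem fullWord_ne_nil {c d : ℕ} {l : List ℕ} (hc : 0 < c) : fullWord (c :: d :: l) ≠ [] := by
  obtain ⟨c, rfl⟩ := Nat.exists_eq_succ_of_ne_zero hc.ne'
  simp [fullWord, List.replicate_succ]

theorem qContFrac_eq_wordPair {F : Type*} [Field F] {t : F} (ht : t ≠ 0)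
    (h : ∀ w, (wordPair t w).1 ≠ 0 ∧ (wordPair t w).2 ≠ 0) :
    ∀ (a : List ℕ), a ≠ [] → Even a.length → (∀ x ∈ a, 0 < x) →
      qContFrac t a =
        (wordPair t (fullWord a).dropLast).1 / (wordPair t (fullWord a).dropLast).2
  | [], h0, _, _ => absurd rfl h0
  | [_], _, he, _ => by simp at he
  | [a, b], _, _, hp => by
    obtain ⟨b, rfl⟩ := Nat.exists_eq_succ_of_ne_zero (hp b (by simp)).ne'
    have hw : (fullWord [a, b.succ]).dropLast =
        List.replicate a Step.R ++ (List.replicate b Step.U ++ []) := by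
      simp [fullWord, List.replicate_succ', ← List.append_assoc]
    have hU := wordPair_replicate_U ht h b []
    -- The empty word has ratio `1`, which supplies the top power of the last `t⁻¹`-integer; this is
    -- why the final `U` is dropped.
    have hs : qInt t⁻¹ b + t⁻¹ ^ b * ((wordPair t []).2 / (wordPair t []).1) =
        qInt t⁻¹ (b + 1) := by
      simp [wordPair, qInt, Finset.sum_range_succ]
    rw [hs] at hU
    rw [hw, wordPair_replicate_R h, qContFrac, qContFrac, ← hU, div_eq_mul_inv (t ^ a), inv_div]
  | a :: b :: c :: d :: l, _, he, hp => by
    have hc := fullWord_ne_nil (d := d) (l := l) (hp c (by simp))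
    have hw : (fullWord (a :: b :: c :: d :: l)).dropLast =
        List.replicate a Step.R ++ (List.replicate b Step.U ++
          (fullWord (c :: d :: l)).dropLast) := by
      rw [fullWord, List.dropLast_append_of_ne_nil (by simp [hc]),
        List.dropLast_append_of_ne_nil hc]
    have ih := qContFrac_eq_wordPair ht h (c :: d :: l) (by simp)
      (by simpa [Nat.even_add_one] using he) (fun x hx => hp x (by simp_all))
    have hU := wordPair_replicate_U ht h b (fullWord (c :: d :: l)).dropLast
    rw [hw, wordPair_replicate_R h, qContFrac, qContFrac, inv_inv, ih,
      div_eq_mul_inv (t⁻¹ ^ b), inv_div, ← hU, div_eq_mul_inv (t ^ a), inv_div]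
  | [_, _, _], _, he, _ => by simp [Nat.even_add_one] at he

theorem dropLast_fullWord {a : List ℕ} (ha : a ≠ []) (ha_even : Even a.length)
    (ha_pos : ∀ x ∈ a, 0 < x) : (fullWord a).dropLast = Step.R :: snakeWord a := by
  match a, ha, ha_even, ha_pos with
  | [_], _, he, _ => simp at he
  | x :: y :: l, _, _, hp =>
    obtain ⟨x, rfl⟩ := Nat.exists_eq_succ_of_ne_zero (hp x (by simp)).ne'
    obtain ⟨y, rfl⟩ := Nat.exists_eq_succ_of_ne_zero (hp y (by simp)).ne'
    simp only [snakeWord, fullWord, List.replicate_succ, List.cons_append, List.tail_cons]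
    rw [List.dropLast_cons_of_ne_nil (by simp)]

theorem qRational_eq {a : List ℕ} (ha : a ≠ []) (ha_even : Even a.length)
    (ha_pos : ∀ x ∈ a, 0 < x) :
    qRational a =
      algebraMap ℤ[X] (RatFunc ℤ)
          (X * (wordPair X (snakeWord a)).1 + (wordPair X (snakeWord a)).2) /
        algebraMap ℤ[X] (RatFunc ℤ) (wordPair X (snakeWord a)).2 := by
  have hX : (RatFunc.X : RatFunc ℤ) ≠ 0 := by
    rw [← RatFunc.algebraMap_X]
    exact RatFunc.algebraMap_ne_zero X_ne_zero
  have h := qContFrac_eq_wordPair hX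
    wordPair_ratFunc_ne_zero a ha ha_even ha_pos
  rw [dropLast_fullWord ha ha_even ha_pos, wordPair_ratFunc] at h
  exact h

/-- A fraction of integer polynomials in lowest terms, with a denominator of positive leading
coefficient, has a unique numerator. -/
theorem numerator_unique {R S R' S' : ℤ[X]} (h : IsRelPrime R S) (h' : IsRelPrime R' S')
    (hS : 0 < S.leadingCoeff) (hS' : 0 < S'.leadingCoeff)
    (heq : algebraMap ℤ[X] (RatFunc ℤ) R / algebraMap ℤ[X] (RatFunc ℤ) S =
      algebraMap ℤ[X] (RatFunc ℤ) R' / algebraMap ℤ[X] (RatFunc ℤ) S') : R = R' := by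
  have hS0 : S ≠ 0 := leadingCoeff_ne_zero.1 hS.ne'
  have hS0' : S' ≠ 0 := leadingCoeff_ne_zero.1 hS'.ne'
  rw [div_eq_div_iff (RatFunc.algebraMap_ne_zero hS0) (RatFunc.algebraMap_ne_zero hS0'),
    ← map_mul, ← map_mul] at heq
  have heq : R * S' = R' * S := RatFunc.algebraMap_injective ℤ heq
  have h1 : S ∣ S' := h.symm.dvd_of_dvd_mul_left ⟨R', by rw [heq, mul_comm]⟩
  have h2 : S' ∣ S := h'.symm.dvd_of_dvd_mul_left ⟨R, by rw [← heq, mul_comm]⟩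
  obtain ⟨u, hu⟩ := associated_of_dvd_dvd h1 h2
  obtain ⟨c, hc, hcu⟩ := Polynomial.isUnit_iff.1 u.isUnit
  have hl : S.leadingCoeff * c = S'.leadingCoeff := by
    rw [← hu, leadingCoeff_mul, ← hcu, leadingCoeff_C]
  -- The units of `ℤ` are `1` and `-1`, and both leading coefficients are positive.
  have hc1 : c = 1 := by
    rcases Int.isUnit_iff.1 hc with rfl | rfl
    · rfl
    · linarith
  have hSS : S = S' := by
    rw [← hu, ← hcu, hc1]
    simp
  rw [← hSS] at heq
  exact mul_right_cancel₀ hS0 heq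

theorem numerator_eq {a : List ℕ} (ha : a ≠ []) (ha_even : Even a.length)
    (ha_pos : ∀ x ∈ a, 0 < x) {R S : ℤ[X]} (hcop : IsRelPrime R S) (hS : 0 < S.leadingCoeff)
    (hRS : qRational a = algebraMap ℤ[X] (RatFunc ℤ) R / algebraMap ℤ[X] (RatFunc ℤ) S) :
    R = X * (wordPair X (snakeWord a)).1 + (wordPair X (snakeWord a)).2 := by
  refine numerator_unique hcop ?_ hS (wordPair_leadingCoeff_pos (snakeWord a))
    (hRS.symm.trans (qRational_eq ha ha_even ha_pos))
  exact (wordPair_isCoprime (Step.R :: snakeWord a)).1.isRelPrime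

theorem eval_numerator (w : List Step) (q : ℤ) :
    (X * (wordPair (X : ℤ[X]) w).1 + (wordPair X w).2).eval q =
      q * (wordPair q w).1 + (wordPair q w).2 := by
  have h := map_wordPair (evalRingHom q) X w
  simp only [coe_evalRingHom, eval_X] at h
  simp [h]

end QSnake

namespace QSnake

/-! ### Order ideals of the poset of tiles -/

/-- `S` is an order ideal of the poset of tiles of the snake graph with word `w`. -/
def IsTileIdeal (w : List Step) (S : Finset (ℕ × ℕ)) : Prop :=
  S ⊆ snakeTiles w ∧ ∀ c ∈ S, ∀ d ∈ snakeTiles w, d ≤ c → d ∈ S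

open Classical in
/-- The order ideals of the poset of tiles of the snake graph with word `w`. -/
noncomputable def tileIdeals (w : List Step) : Finset (Finset (ℕ × ℕ)) :=
  (snakeTiles w).powerset.filter (IsTileIdeal w)

theorem mem_tileIdeals {w : List Step} {S : Finset (ℕ × ℕ)} :
    S ∈ tileIdeals w ↔ IsTileIdeal w S := by
  simp only [tileIdeals, Finset.mem_filter, Finset.mem_powerset, and_iff_right_iff_imp]
  exact fun h => h.1

/-- Moving a tile one column to the right. -/
def shiftRight (c : ℕ × ℕ) : ℕ × ℕ := (c.1, c.2 + 1)

theorem shiftRight_injective : Function.Injective shiftRight := by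
  rintro ⟨a, b⟩ ⟨c, d⟩ h
  simpa [shiftRight] using h

theorem shiftRight_le_shiftRight {c d : ℕ × ℕ} : shiftRight c ≤ shiftRight d ↔ c ≤ d := by
  simp [shiftRight, Prod.le_def]

theorem snakeTiles_cons_R (w : List Step) :
    snakeTiles (Step.R :: w) = insert (w.count Step.U, 0) ((snakeTiles w).image shiftRight) := rfl

theorem snakeTiles_cons_U (w : List Step) :
    snakeTiles (Step.U :: w) = insert (w.count Step.U + 1, 0) (snakeTiles w) := rfl

theorem first_notMem_image_shiftRight (n : ℕ) (S : Finset (ℕ × ℕ)) :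
    (n, 0) ∉ S.image shiftRight := by
  simp [shiftRight]

theorem first_notMem_of_subset {w : List Step} {S : Finset (ℕ × ℕ)} (h : S ⊆ snakeTiles w) :
    (w.count Step.U + 1, 0) ∉ S := fun h' => by
  have := snakeTiles_row_le w _ (h h')
  simp at this

/-- The new tile is minimal, being alone in column `0`, so once it is present it imposes nothing on
the others. -/
theorem isTileIdeal_cons_R_insert {w : List Step} {S : Finset (ℕ × ℕ)} :
    IsTileIdeal (Step.R :: w) (insert (w.count Step.U, 0) (S.image shiftRight)) ↔
      IsTileIdeal w S := by
  simp only [IsTileIdeal, snakeTiles_cons_R]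
  rw [Finset.insert_subset_insert_iff (first_notMem_image_shiftRight _ _),
    Finset.image_subset_image_iff shiftRight_injective]
  refine and_congr_right fun hS => ⟨fun h c hc d hd hdc => ?_, fun h c hc d hd hdc => ?_⟩
  · have := h (shiftRight c) (Finset.mem_insert_of_mem (Finset.mem_image_of_mem _ hc))
      (shiftRight d) (Finset.mem_insert_of_mem (Finset.mem_image_of_mem _ hd))
      (shiftRight_le_shiftRight.2 hdc)
    rcases Finset.mem_insert.1 this with h1 | h1
    · simp [shiftRight] at h1
    · exact (shiftRight_injective.mem_finset_image).1 h1
  · rcases Finset.mem_insert.1 hd with rfl | hd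
    · exact Finset.mem_insert_self _ _
    obtain ⟨d, hdT, rfl⟩ := Finset.mem_image.1 hd
    refine Finset.mem_insert_of_mem (Finset.mem_image_of_mem _ ?_)
    rcases Finset.mem_insert.1 hc with rfl | hc
    · simp [shiftRight, Prod.le_def] at hdc
    obtain ⟨c, hcS, rfl⟩ := Finset.mem_image.1 hc
    exact h c hcS d hdT (shiftRight_le_shiftRight.1 hdc)

/-- Any tile above the new one is also above the old first tile, so leaving out the new tile amounts
to leaving out the old first one. -/
theorem isTileIdeal_cons_R {w : List Step} {S : Finset (ℕ × ℕ)} :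
    IsTileIdeal (Step.R :: w) (S.image shiftRight) ↔
      IsTileIdeal w S ∧ (w.count Step.U, 0) ∉ S := by
  simp only [IsTileIdeal, snakeTiles_cons_R]
  rw [Finset.subset_insert_iff_of_notMem (first_notMem_image_shiftRight _ _),
    Finset.image_subset_image_iff shiftRight_injective, and_assoc]
  refine and_congr_right fun hS => ⟨fun h => ⟨fun c hc d hd hdc => ?_, fun hf => ?_⟩,
    fun ⟨h, hf⟩ c hc d hd hdc => ?_⟩
  · exact (shiftRight_injective.mem_finset_image).1 (h (shiftRight c)
      (Finset.mem_image_of_mem _ hc) (shiftRight d)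
      (Finset.mem_insert_of_mem (Finset.mem_image_of_mem _ hd)) (shiftRight_le_shiftRight.2 hdc))
  · exact first_notMem_image_shiftRight _ _ (h _ (Finset.mem_image_of_mem _ hf) _
      (Finset.mem_insert_self _ _) (by simp [shiftRight, Prod.le_def]))
  · obtain ⟨c, hcS, rfl⟩ := Finset.mem_image.1 hc
    rcases Finset.mem_insert.1 hd with rfl | hd
    · exact absurd (h c hcS _ (snakeTiles_first_mem w) ⟨hdc.1, Nat.zero_le _⟩) hf
    obtain ⟨d, hdT, rfl⟩ := Finset.mem_image.1 hd
    exact Finset.mem_image_of_mem _ (h c hcS d hdT (shiftRight_le_shiftRight.1 hdc))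

theorem isTileIdeal_cons_U {w : List Step} {S : Finset (ℕ × ℕ)} (hS : S ⊆ snakeTiles w) :
    IsTileIdeal (Step.U :: w) S ↔ IsTileIdeal w S := by
  simp only [IsTileIdeal, snakeTiles_cons_U, hS, hS.trans (Finset.subset_insert _ _), true_and]
  refine ⟨fun h c hc d hd => h c hc d (Finset.mem_insert_of_mem hd), fun h c hc d hd hdc => ?_⟩
  rcases Finset.mem_insert.1 hd with rfl | hd
  · have h1 := snakeTiles_row_le w _ (hS hc)
    have h2 : w.count Step.U + 1 ≤ c.1 := hdc.1
    omega
  · exact h c hc d hd hdc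

/-- The old tiles below the new one lie in column `0`, and all of them are below the old first tile.
-/
theorem isTileIdeal_cons_U_insert {w : List Step} {S : Finset (ℕ × ℕ)}
    (hS : S ⊆ snakeTiles w) :
    IsTileIdeal (Step.U :: w) (insert (w.count Step.U + 1, 0) S) ↔
      IsTileIdeal w S ∧ (w.count Step.U, 0) ∈ S := by
  simp only [IsTileIdeal, snakeTiles_cons_U, hS, Finset.insert_subset_insert _ hS, true_and]
  refine ⟨fun h => ⟨fun c hc d hd hdc => ?_, ?_⟩, fun ⟨h, hf⟩ c hc d hd hdc => ?_⟩
  · rcases Finset.mem_insert.1 (h c (Finset.mem_insert_of_mem hc) d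
      (Finset.mem_insert_of_mem hd) hdc) with rfl | h1
    · exact absurd hd (first_notMem_of_subset subset_rfl)
    · exact h1
  · have := h _ (Finset.mem_insert_self _ _) _
      (Finset.mem_insert_of_mem (snakeTiles_first_mem w)) (by simp [Prod.le_def])
    simpa using this
  · rcases Finset.mem_insert.1 hd with rfl | hd
    · exact Finset.mem_insert_self _ _
    refine Finset.mem_insert_of_mem ?_
    rcases Finset.mem_insert.1 hc with rfl | hc
    · exact h _ hf d hd ⟨snakeTiles_row_le w d hd, hdc.2⟩
    · exact h c hc d hd hdc

/-- A set of tiles is obtained from a set of tiles of the shorter snake graph by possibly adding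
the first tile. -/
theorem exists_image_shiftRight {w : List Step} {S : Finset (ℕ × ℕ)}
    (hS : S ⊆ snakeTiles (Step.R :: w)) :
    ∃ S' ⊆ snakeTiles w, S.erase (w.count Step.U, 0) = S'.image shiftRight := by
  rw [snakeTiles_cons_R, Finset.subset_insert_iff] at hS
  obtain ⟨S', h1, h2⟩ := Finset.subset_image_iff.1 hS
  exact ⟨S', h1, h2.symm⟩

/-- The generating functions, by size, of the order ideals of tiles that contain, respectively do
not contain, the first tile. -/
theorem sum_tileIdeals_filter {A : Type*} [CommSemiring A] (t : A) (w : List Step) :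
    (∑ S ∈ tileIdeals w with (w.count Step.U, 0) ∈ S, t ^ S.card = t * (wordPair t w).1) ∧
      ∑ S ∈ tileIdeals w with (w.count Step.U, 0) ∉ S, t ^ S.card = (wordPair t w).2 := by
  induction w with
  | nil =>
    have h : tileIdeals [] = {∅, {(0, 0)}} := by
      ext S
      rw [mem_tileIdeals, IsTileIdeal, snakeTiles, Finset.subset_singleton_iff]
      simp only [Finset.mem_insert, Finset.mem_singleton, and_iff_left_iff_imp]
      rintro (rfl | rfl) <;> simp
    rw [h]
    constructor
    · rw [Finset.filter_insert, Finset.filter_singleton]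
      simp [wordPair]
    · rw [Finset.filter_insert, Finset.filter_singleton]
      simp [wordPair]
  | cons s w ih =>
    have hsum : ∑ S ∈ tileIdeals w, t ^ S.card = t * (wordPair t w).1 + (wordPair t w).2 := by
      rw [← ih.1, ← ih.2, Finset.sum_filter_add_sum_filter_not]
    cases s
    · have hc : (Step.R :: w).count Step.U = w.count Step.U := by simp
      rw [hc]
      simp only [wordPair]
      constructor
      -- The minimal new tile can be added to every ideal; without it, only ideals avoiding the old
      -- first tile remain.
      · rw [← hsum, Finset.mul_sum]
        symm
        refine Finset.sum_bij
          (fun S _ => insert (w.count Step.U, 0) (S.image shiftRight)) ?_ ?_ ?_ ?_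
        · intro S hS
          rw [Finset.mem_filter, mem_tileIdeals, isTileIdeal_cons_R_insert]
          exact ⟨mem_tileIdeals.1 hS, Finset.mem_insert_self _ _⟩
        · intro S _ S' _ h
          have := congrArg (fun T => T.erase (w.count Step.U, 0)) h
          simp only [Finset.erase_insert (first_notMem_image_shiftRight _ _)] at this
          exact Finset.image_injective shiftRight_injective this
        · intro S hS
          rw [Finset.mem_filter, mem_tileIdeals] at hS
          obtain ⟨S', -, h⟩ := exists_image_shiftRight hS.1.1
          have h' : insert (w.count Step.U, 0) (S'.image shiftRight) = S := by
            rw [← h, Finset.insert_erase hS.2]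
          refine ⟨S', ?_, h'⟩
          rw [mem_tileIdeals, ← isTileIdeal_cons_R_insert, h']
          exact hS.1
        · intro S _
          rw [Finset.card_insert_of_notMem (first_notMem_image_shiftRight _ _),
            Finset.card_image_of_injective _ shiftRight_injective, pow_succ']
      · rw [← ih.2]
        symm
        refine Finset.sum_bij (fun S _ => S.image shiftRight) ?_ ?_ ?_ ?_
        · intro S hS
          rw [Finset.mem_filter, mem_tileIdeals] at hS ⊢
          exact ⟨isTileIdeal_cons_R.2 hS, first_notMem_image_shiftRight _ _⟩
        · intro S _ S' _ h
          exact Finset.image_injective shiftRight_injective h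
        · intro S hS
          rw [Finset.mem_filter, mem_tileIdeals] at hS
          obtain ⟨S', -, h⟩ := exists_image_shiftRight hS.1.1
          rw [Finset.erase_eq_of_notMem hS.2] at h
          refine ⟨S', ?_, h.symm⟩
          rw [Finset.mem_filter, mem_tileIdeals, ← isTileIdeal_cons_R, ← h]
          exact hS.1
        · intro S _
          rw [Finset.card_image_of_injective _ shiftRight_injective]
    · have hc : (Step.U :: w).count Step.U = w.count Step.U + 1 := by simp
      rw [hc]
      simp only [wordPair]
      constructor
      · rw [← ih.1, Finset.mul_sum]
        symm
        refine Finset.sum_bij (fun S _ => insert (w.count Step.U + 1, 0) S) ?_ ?_ ?_ ?_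
        · intro S hS
          rw [Finset.mem_filter, mem_tileIdeals] at hS ⊢
          exact ⟨(isTileIdeal_cons_U_insert hS.1.1).2 hS, Finset.mem_insert_self _ _⟩
        · intro S hS S' hS' h
          rw [Finset.mem_filter, mem_tileIdeals] at hS hS'
          have := congrArg (fun T => T.erase (w.count Step.U + 1, 0)) h
          simpa only [Finset.erase_insert (first_notMem_of_subset hS.1.1),
            Finset.erase_insert (first_notMem_of_subset hS'.1.1)] using this
        · intro S hS
          rw [Finset.mem_filter, mem_tileIdeals] at hS
          have hsub := hS.1.1
          rw [snakeTiles_cons_U, Finset.subset_insert_iff] at hsub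
          refine ⟨S.erase (w.count Step.U + 1, 0), ?_, Finset.insert_erase hS.2⟩
          rw [Finset.mem_filter, mem_tileIdeals, ← isTileIdeal_cons_U_insert hsub,
            Finset.insert_erase hS.2]
          exact hS.1
        · intro S hS
          rw [Finset.mem_filter, mem_tileIdeals] at hS
          rw [Finset.card_insert_of_notMem (first_notMem_of_subset hS.1.1), pow_succ']
      -- Without the maximal new tile, the ideals are exactly those of the shorter word.
      · rw [← hsum]
        refine Finset.sum_congr ?_ fun _ _ => rfl
        ext S
        rw [Finset.mem_filter, mem_tileIdeals, mem_tileIdeals]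
        constructor
        · rintro ⟨h1, h2⟩
          have hsub := h1.1
          rw [snakeTiles_cons_U, Finset.subset_insert_iff_of_notMem h2] at hsub
          exact (isTileIdeal_cons_U hsub).1 h1
        · exact fun h => ⟨(isTileIdeal_cons_U h.1).2 h, first_notMem_of_subset h.1⟩

theorem sum_tileIdeals {A : Type*} [CommSemiring A] (t : A) (w : List Step) :
    ∑ S ∈ tileIdeals w, t ^ S.card = t * (wordPair t w).1 + (wordPair t w).2 := by
  rw [← (sum_tileIdeals_filter t w).1, ← (sum_tileIdeals_filter t w).2,
    Finset.sum_filter_add_sum_filter_not]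

/-! ### Partitions between `μ` and `λ` -/

theorem snakeTiles_subset_outerShape (w : List Step) : snakeTiles w ⊆ (outerShape w).cells :=
  fun c hc => ((mem_snakeTiles_iff w c.1 c.2).1 hc).1

theorem innerShape_cells (w : List Step) :
    (innerShape w).cells = (outerShape w).cells \ snakeTiles w := rfl

theorem finite_Icc_youngDiagram (μ Λ : YoungDiagram) : (Set.Icc μ Λ).Finite := by
  refine Set.Finite.of_finite_image (f := YoungDiagram.cells) ?_ ?_
  · refine (Λ.cells.powerset.finite_toSet).subset ?_
    rintro _ ⟨ν, hν, rfl⟩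
    simpa using YoungDiagram.cells_subset_iff.2 hν.2
  · exact fun _ _ _ _ h => YoungDiagram.ext h

/-- The Young diagram obtained by adding an order ideal of tiles to the inner shape. -/
def addIdeal (w : List Step) (S : Finset (ℕ × ℕ)) (hS : IsTileIdeal w S) : YoungDiagram where
  cells := (innerShape w).cells ∪ S
  isLowerSet := by
    intro c d hdc hc
    simp only [Finset.coe_union, Set.mem_union, Finset.mem_coe] at hc ⊢
    rcases hc with hc | hc
    · exact Or.inl ((innerShape w).isLowerSet hdc hc)
    · by_cases hd : d ∈ snakeTiles w
      · exact Or.inr (hS.2 c hc d hd hdc)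
      · refine Or.inl ?_
        rw [innerShape_cells, Finset.mem_sdiff]
        exact ⟨(outerShape w).isLowerSet hdc (snakeTiles_subset_outerShape w (hS.1 hc)), hd⟩

/-- Adding an ideal `S` to `μ` is a bijection onto the interval, with inverse `ν ↦ ν \ μ`, and `|ν|
= |μ| + |S|`. -/
theorem sum_Icc_innerShape_outerShape {A : Type*} [CommSemiring A] (t : A) (w : List Step) :
    ∑ ν ∈ (finite_Icc_youngDiagram (innerShape w) (outerShape w)).toFinset, t ^ ν.card =
      t ^ (innerShape w).card * (t * (wordPair t w).1 + (wordPair t w).2) := by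
  rw [← sum_tileIdeals, Finset.mul_sum]
  symm
  have hdisj : ∀ S, IsTileIdeal w S → Disjoint (innerShape w).cells S := fun S hS => by
    rw [innerShape_cells]
    exact Finset.sdiff_disjoint.mono_right hS.1
  refine Finset.sum_bij (fun S hS => addIdeal w S (mem_tileIdeals.1 hS)) ?_ ?_ ?_ ?_
  · intro S hS
    rw [mem_tileIdeals] at hS
    rw [Set.Finite.mem_toFinset]
    constructor
    · exact YoungDiagram.cells_subset_iff.1 Finset.subset_union_left
    · refine YoungDiagram.cells_subset_iff.1 (Finset.union_subset ?_
        (hS.1.trans (snakeTiles_subset_outerShape w)))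
      rw [innerShape_cells]
      exact Finset.sdiff_subset
  · intro S hS S' hS' h
    have h1 := congrArg (fun ν : YoungDiagram => ν.cells \ (innerShape w).cells) h
    simp only [addIdeal] at h1
    rwa [Finset.union_sdiff_cancel_left (hdisj S (mem_tileIdeals.1 hS)),
      Finset.union_sdiff_cancel_left (hdisj S' (mem_tileIdeals.1 hS'))] at h1
  · intro ν hν
    rw [Set.Finite.mem_toFinset] at hν
    have h1 := YoungDiagram.cells_subset_iff.2 hν.1
    have h2 := YoungDiagram.cells_subset_iff.2 hν.2
    refine ⟨ν.cells \ (innerShape w).cells, ?_, ?_⟩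
    · rw [mem_tileIdeals]
      constructor
      · intro c hc
        rw [Finset.mem_sdiff, innerShape_cells, Finset.mem_sdiff] at hc
        by_contra h
        exact hc.2 ⟨h2 hc.1, h⟩
      · intro c hc d hd hdc
        rw [Finset.mem_sdiff] at hc ⊢
        refine ⟨ν.isLowerSet hdc hc.1, ?_⟩
        rw [innerShape_cells, Finset.mem_sdiff]
        exact fun h => h.2 hd
    · exact YoungDiagram.ext (Finset.union_sdiff_of_subset h1)
  · intro S hS
    rw [← pow_add]
    exact congrArg _ (Finset.card_union_of_disjoint (hdisj S (mem_tileIdeals.1 hS))).symm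

end QSnake

namespace QSnake

/-! ### Matrices in reduced row echelon form -/

section Echelon

variable {K : Type*} [Field K] {k n : ℕ} {p p' : Fin k → ℕ} {M M' : Matrix (Fin k) (Fin n) K}

theorem IsEchelon.apply_pivot (h : IsEchelon p M) (hp : ∀ i, p i < n) (i i' : Fin k) :
    M i ⟨p i', hp i'⟩ = if i = i' then 1 else 0 :=
  h.2 i i' _ rfl

/-- A vector in the row space is recovered from its entries in the pivot columns. -/
theorem IsEchelon.eq_sum_of_mem_span (h : IsEchelon p M) (hp : ∀ i, p i < n) {v : Fin n → K}
    (hv : v ∈ Submodule.span K (Set.range M.row)) : v = ∑ i, v ⟨p i, hp i⟩ • M.row i := by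
  obtain ⟨c, rfl⟩ := (Submodule.mem_span_range_iff_exists_fun K).1 hv
  refine Finset.sum_congr rfl fun i _ => ?_
  congr 1
  simp [Finset.sum_apply, Matrix.row, h.apply_pivot hp]

theorem IsEchelon.linearIndependent (h : IsEchelon p M) (hp : ∀ i, p i < n) :
    LinearIndependent K M.row := by
  rw [Fintype.linearIndependent_iff]
  intro g hg i
  have := congrFun hg ⟨p i, hp i⟩
  simpa [Finset.sum_apply, Matrix.row, h.apply_pivot hp] using this

theorem IsEchelon.finrank_span (h : IsEchelon p M) (hp : ∀ i, p i < n) :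
    Module.finrank K (Submodule.span K (Set.range M.row)) = k := by
  rw [finrank_span_eq_card (h.linearIndependent hp), Fintype.card_fin]

/-- Expand row `i` of `M` in the rows of `M'` and look at column `p i`. Some term `i'` is nonzero
there: its matrix entry forces `p' i' ≤ p i`, and its coefficient, the entry of row `i` in column
`p' i'`, forces `p i ≤ p' i'`. -/
theorem IsEchelon.range_subset (h : IsEchelon p M) (h' : IsEchelon p' M') (hp : ∀ i, p i < n)
    (hp' : ∀ i, p' i < n)
    (hspan : Submodule.span K (Set.range M.row) = Submodule.span K (Set.range M'.row)) :
    Set.range p ⊆ Set.range p' := by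
  rintro _ ⟨i, rfl⟩
  have hi : M.row i ∈ Submodule.span K (Set.range M'.row) :=
    hspan ▸ Submodule.subset_span (Set.mem_range_self i)
  have h1 := congrFun (h'.eq_sum_of_mem_span hp' hi) ⟨p i, hp i⟩
  have h2 : M.row i ⟨p i, hp i⟩ ≠ 0 := by simp [Matrix.row, h.apply_pivot hp]
  rw [h1, Finset.sum_apply] at h2
  obtain ⟨i', -, h3⟩ := Finset.exists_ne_zero_of_sum_ne_zero h2
  rw [Pi.smul_apply, smul_eq_mul] at h3
  refine ⟨i', le_antisymm ?_ ?_⟩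
  · by_contra! hlt
    exact right_ne_zero_of_mul h3 (h'.1 i' _ hlt)
  · by_contra! hlt
    exact left_ne_zero_of_mul h3 (h.1 i _ hlt)

theorem IsEchelon.pivots_eq (h : IsEchelon p M) (h' : IsEchelon p' M') (hp : ∀ i, p i < n)
    (hp' : ∀ i, p' i < n) (hm : StrictMono p) (hm' : StrictMono p')
    (hspan : Submodule.span K (Set.range M.row) = Submodule.span K (Set.range M'.row)) :
    p = p' :=
  (hm.range_inj hm').1 ((h.range_subset h' hp hp' hspan).antisymm
    (h'.range_subset h hp' hp hspan.symm))

theorem IsEchelon.eq_of_span_eq (h : IsEchelon p M) (h' : IsEchelon p M') (hp : ∀ i, p i < n)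
    (hspan : Submodule.span K (Set.range M.row) = Submodule.span K (Set.range M'.row)) :
    M = M' := by
  ext i j
  have hi : M.row i ∈ Submodule.span K (Set.range M'.row) :=
    hspan ▸ Submodule.subset_span (Set.mem_range_self i)
  have h1 := h'.eq_sum_of_mem_span hp hi
  have hc : ∀ i', M.row i ⟨p i', hp i'⟩ = if i = i' then 1 else 0 := h.apply_pivot hp i
  simp only [hc, ite_smul, one_smul, zero_smul, Finset.sum_ite_eq, Finset.mem_univ,
    if_true] at h1
  exact congrFun h1 j

/-- The columns in which row `i` of a matrix in echelon form with pivots `p` is unconstrained. -/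
def freeColumns (n : ℕ) (p : Fin k → ℕ) (i : Fin k) : Finset (Fin n) :=
  {j | p i < j ∧ ∀ i', p i' ≠ j}

open Classical in
-- The echelon condition constrains each entry separately, so the echelon matrices form a product of
-- sets and can be counted entry by entry.
theorem isEchelon_iff (hm : StrictMono p) :
    IsEchelon p M ↔ ∀ i j, M i j ∈ (if j ∈ freeColumns n p i then Set.univ else
      {if (j : ℕ) = p i then (1 : K) else 0}) := by
  constructor
  · intro h i j
    split_ifs with hf hj
    · trivial
    · simpa using h.2 i i j hj
    · rw [Set.mem_singleton_iff]
      by_cases hlt : (j : ℕ) < p i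
      · exact h.1 i j hlt
      · have : ∃ i', p i' = j := by
          by_contra! hne
          exact hf (by simp [freeColumns]; exact ⟨by omega, hne⟩)
        obtain ⟨i', hi'⟩ := this
        rw [h.2 i i' j hi'.symm, if_neg]
        rintro rfl
        exact hj hi'.symm
  · intro h
    constructor
    · intro i j hj
      have := h i j
      rwa [if_neg (by simp [freeColumns]; omega), if_neg (by omega), Set.mem_singleton_iff] at this
    · intro i i' j hj
      have := h i j
      rw [if_neg (by simp [freeColumns]; exact fun _ => ⟨i', hj.symm⟩), Set.mem_singleton_iff,
        hj] at this
      rw [this]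
      simp [hm.injective.eq_iff, eq_comm]

/-- The columns to the right of pivot `i` are the free columns of row `i` and the pivots of the
later rows. -/
theorem card_freeColumns (hp : ∀ i, p i < n) (hm : StrictMono p) (i : Fin k) :
    (freeColumns n p i).card + (k - 1 - i) = n - 1 - p i := by
  have h1 : (Finset.Ioi i).card = k - 1 - i := Fin.card_Ioi i
  have h2 : (Finset.Ioi (⟨p i, hp i⟩ : Fin n)).card = n - 1 - p i := Fin.card_Ioi _
  let f : Fin k → Fin n := fun i => ⟨p i, hp i⟩
  have hf : Function.Injective f := fun a b h => hm.injective (by simpa [f] using h)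
  rw [← h1, ← h2, ← Finset.card_image_of_injective _ hf, ← Finset.card_union_of_disjoint]
  · congr 1
    ext j
    simp only [freeColumns, Finset.mem_union, Finset.mem_filter, Finset.mem_univ, true_and,
      Finset.mem_image, Finset.mem_Ioi, f, Fin.ext_iff, Fin.lt_def]
    constructor
    · rintro (h | ⟨i', h, h'⟩)
      · exact h.1
      · rw [← h']
        exact hm h
    · intro h
      by_cases hj : ∃ i', p i' = j
      · obtain ⟨i', hi'⟩ := hj
        right
        refine ⟨i', ?_, hi'⟩
        rw [← hi'] at h
        exact hm.lt_iff_lt.1 h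
      · push Not at hj
        exact Or.inl ⟨h, hj⟩
  · rw [Finset.disjoint_left]
    intro j hj hj'
    simp only [freeColumns, Finset.mem_filter, Finset.mem_univ, true_and] at hj
    obtain ⟨i', -, rfl⟩ := Finset.mem_image.1 hj'
    exact hj.2 i' rfl

theorem ncard_isEchelon [Fintype K] (hm : StrictMono p) :
    {M : Matrix (Fin k) (Fin n) K | IsEchelon p M}.ncard =
      Fintype.card K ^ ∑ i, (freeColumns n p i).card := by
  classical
  let T : Fin k → Fin n → Finset K := fun i j =>
    if j ∈ freeColumns n p i then Finset.univ else {if (j : ℕ) = p i then (1 : K) else 0}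
  have hT : {M : Matrix (Fin k) (Fin n) K | IsEchelon p M} =
      Set.image Matrix.of ↑(Fintype.piFinset fun i => Fintype.piFinset (T i)) := by
    ext M
    rw [Set.mem_ofPred_eq, isEchelon_iff hm, Set.mem_image_equiv, Finset.mem_coe]
    simp only [Fintype.mem_piFinset, T, Matrix.of_symm_apply]
    refine forall_congr' fun i => forall_congr' fun j => ?_
    split_ifs <;> simp
  rw [hT, Set.ncard_image_of_injective _ Matrix.of.injective, Set.ncard_coe_finset, Fintype.card_piFinset, ← Finset.prod_pow_eq_pow_sum]
  refine Finset.prod_congr rfl fun i _ => ?_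
  rw [Fintype.card_piFinset]
  have : ∀ j, (T i j).card = if j ∈ freeColumns n p i then Fintype.card K else 1 := by
    intro j
    simp only [T]
    split_ifs <;> simp
  simp only [this, Finset.prod_ite_mem, Finset.univ_inter, Finset.prod_const]

end Echelon

/-! ### Schubert cells -/

section Schubert

variable {k n : ℕ} {ν ν' : YoungDiagram}

theorem pivot_strictMono (k n : ℕ) (ν : YoungDiagram) : StrictMono (pivot k n ν) := by
  intro i j hij
  have h1 := ν.rowLen_anti i j (le_of_lt hij)
  have h2 : (i : ℕ) < j := hij
  simp only [pivot]
  omega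

theorem pivot_lt (hkn : k ≤ n) (ν : YoungDiagram) (i : Fin k) : pivot k n ν i < n := by
  have := i.2
  simp only [pivot]
  omega

theorem sum_rowLen (hν : ∀ c ∈ ν, c.1 < k) : ∑ i : Fin k, ν.rowLen i = ν.card := by
  rw [Fin.sum_univ_eq_sum_range (fun i => ν.rowLen i) k]
  rw [show ν.card = ν.cells.card from rfl,
    Finset.card_eq_sum_card_fiberwise (f := Prod.fst) (t := Finset.range k)
      (fun c hc => by simpa using hν c hc)]
  exact Finset.sum_congr rfl fun i _ => ν.rowLen_eq_card

theorem card_freeColumns_pivot (hkn : k ≤ n) (hν : ∀ c ∈ ν, c.2 < n - k) (i : Fin k) :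
    (freeColumns n (pivot k n ν) i).card = ν.rowLen i := by
  have h := card_freeColumns (pivot_lt hkn ν) (pivot_strictMono k n ν) i
  -- This bound keeps the subtraction in `pivot` from truncating.
  have hr : ν.rowLen i ≤ n - k := by
    by_contra! hlt
    exact lt_irrefl _ (hν (i, n - k) (YoungDiagram.mem_iff_lt_rowLen.2 hlt))
  have := i.2
  simp only [pivot] at h
  omega

theorem ncard_openSchubertCell (K : Type*) [Field K] [Fintype K] (hkn : k ≤ n)
    (hν : ∀ c ∈ ν, c.1 < k ∧ c.2 < n - k) :
    (openSchubertCell K k n ν).ncard = Fintype.card K ^ ν.card := by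
  have hp := pivot_lt hkn ν
  rw [← sum_rowLen fun c hc => (hν c hc).1,
    ← Finset.sum_congr rfl fun i _ => card_freeColumns_pivot hkn (fun c hc => (hν c hc).2) i,
    ← ncard_isEchelon (pivot_strictMono k n ν)]
  symm
  refine Set.ncard_congr
    (fun M (hM : IsEchelon _ M) => ⟨Submodule.span K (Set.range M.row), hM.finrank_span hp⟩)
    ?_ ?_ ?_
  · exact fun M hM => ⟨M, hM, rfl⟩
  · exact fun M M' hM hM' h => IsEchelon.eq_of_span_eq hM hM' hp (Subtype.ext_iff.1 h)
  · rintro V ⟨M, hM, hV⟩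
    exact ⟨M, hM, Subtype.ext hV.symm⟩

theorem eq_of_pivot_eq (hν : ∀ c ∈ ν, c.1 < k ∧ c.2 < n - k)
    (hν' : ∀ c ∈ ν', c.1 < k ∧ c.2 < n - k) (h : pivot k n ν = pivot k n ν') : ν = ν' := by
  have bound : ∀ ν : YoungDiagram, (∀ c ∈ ν, c.1 < k ∧ c.2 < n - k) → ∀ i,
      ν.rowLen i ≤ n - k := by
    intro ν hν i
    by_contra! hlt
    exact lt_irrefl _ (hν (i, n - k) (YoungDiagram.mem_iff_lt_rowLen.2 hlt)).2
  have hrow : ∀ i < k, ν.rowLen i = ν'.rowLen i := by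
    intro i hi
    have h1 := congrFun h ⟨i, hi⟩
    have h2 := bound ν hν i
    have h3 := bound ν' hν' i
    simp only [pivot] at h1
    omega
  refine YoungDiagram.ext (Finset.ext fun c => ?_)
  rw [YoungDiagram.mem_cells, YoungDiagram.mem_cells]
  constructor <;> intro hc
  · have := hrow c.1 (hν c hc).1
    exact YoungDiagram.mem_iff_lt_rowLen.2 (this ▸ YoungDiagram.mem_iff_lt_rowLen.1 hc)
  · have := hrow c.1 (hν' c hc).1
    exact YoungDiagram.mem_iff_lt_rowLen.2 (this ▸ YoungDiagram.mem_iff_lt_rowLen.1 hc)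

theorem disjoint_openSchubertCell (K : Type*) [Field K] (hkn : k ≤ n)
    (hν : ∀ c ∈ ν, c.1 < k ∧ c.2 < n - k) (hν' : ∀ c ∈ ν', c.1 < k ∧ c.2 < n - k)
    (hne : ν ≠ ν') : Disjoint (openSchubertCell K k n ν) (openSchubertCell K k n ν') := by
  rw [Set.disjoint_left]
  rintro V ⟨M, hM, hV⟩ ⟨M', hM', hV'⟩
  exact hne (eq_of_pivot_eq hν hν' (hM.pivots_eq hM' (pivot_lt hkn ν) (pivot_lt hkn ν')
    (pivot_strictMono k n ν) (pivot_strictMono k n ν') (hV.symm.trans hV')))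

/-- The number of points of a union of Schubert cells over an interval of partitions. -/
theorem ncard_iUnion_openSchubertCell (K : Type*) [Field K] [Fintype K] (hkn : k ≤ n)
    (μ Λ : YoungDiagram) (hΛ : ∀ c ∈ Λ, c.1 < k ∧ c.2 < n - k) :
    (⋃ ν ∈ Set.Icc μ Λ, openSchubertCell K k n ν).ncard =
      ∑ ν ∈ (finite_Icc_youngDiagram μ Λ).toFinset, Fintype.card K ^ ν.card := by
  have hfin : Finite (Gr K k n) := Subtype.finite
  have hb : ∀ ν ∈ Set.Icc μ Λ, ∀ c ∈ ν, c.1 < k ∧ c.2 < n - k := fun ν hν c hc =>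
    hΛ c (hν.2 hc)
  rw [(finite_Icc_youngDiagram μ Λ).ncard_biUnion (fun _ _ => Set.toFinite _)
    (fun ν hν ν' hν' hne => disjoint_openSchubertCell K hkn (hb ν hν) (hb ν' hν') hne),
    finsum_mem_eq_finite_toFinset_sum _ (finite_Icc_youngDiagram μ Λ)]
  refine Finset.sum_congr rfl fun ν hν => ?_
  exact ncard_openSchubertCell K hkn (hb ν ((Set.Finite.mem_toFinset _).1 hν))

end Schubert

/-! ### The bounding box of the snake graph -/

theorem snakeTiles_col_le (w : List Step) : ∀ e ∈ snakeTiles w, e.2 ≤ w.count Step.R := by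
  induction w with
  | nil => simp [snakeTiles]
  | cons s w ih =>
    cases s
    · intro e he
      rcases Finset.mem_insert.1 he with rfl | he
      · simp
      · obtain ⟨c, hc, rfl⟩ := Finset.mem_image.1 he
        simpa using ih c hc
    · intro e he
      rcases Finset.mem_insert.1 he with rfl | he
      · simp
      · simpa using ih e he

theorem mem_outerShape_le {w : List Step} {c : ℕ × ℕ} (hc : c ∈ outerShape w) :
    c.1 ≤ w.count Step.U ∧ c.2 ≤ w.count Step.R := by
  obtain ⟨e, he, h1, h2⟩ := mem_outerShape.1 hc
  exact ⟨h1.trans (snakeTiles_row_le w e he), h2.trans (snakeTiles_col_le w e he)⟩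

theorem count_fullWord : ∀ a : List ℕ, Even a.length →
    (fullWord a).count Step.U = evenSum a ∧
      (fullWord a).count Step.R + evenSum a = a.sum
  | [], _ => by simp [fullWord, evenSum]
  | [_], h => by simp at h
  | x :: y :: l, h => by
    have ih := count_fullWord l (by simpa [Nat.even_add_one] using h)
    simp only [fullWord, evenSum, List.count_append, List.count_replicate, List.sum_cons]
    constructor
    · simp [ih.1]
    · simp
      omega

theorem fullWord_eq_append : ∀ a : List ℕ, a ≠ [] → Even a.length → (∀ x ∈ a, 0 < x) →
    ∃ u, fullWord a = u ++ [Step.U]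
  | [], h, _, _ => absurd rfl h
  | [_], _, h, _ => by simp at h
  | [x, y], _, _, hp => by
    obtain ⟨y, rfl⟩ := Nat.exists_eq_succ_of_ne_zero (hp y (by simp)).ne'
    exact ⟨List.replicate x Step.R ++ List.replicate y Step.U, by
      simp [fullWord, List.replicate_succ']⟩
  | x :: y :: z :: l, _, h, hp => by
    obtain ⟨u, hu⟩ := fullWord_eq_append (z :: l) (by simp)
      (by simpa [Nat.even_add_one] using h) (fun v hv => hp v (by simp_all))
    exact ⟨List.replicate x Step.R ++ (List.replicate y Step.U ++ u), by
      simp [fullWord, hu]⟩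

theorem fullWord_eq {a : List ℕ} (ha : a ≠ []) (ha_even : Even a.length)
    (ha_pos : ∀ x ∈ a, 0 < x) : fullWord a = Step.R :: (snakeWord a ++ [Step.U]) := by
  obtain ⟨u, hu⟩ := fullWord_eq_append a ha ha_even ha_pos
  have h := dropLast_fullWord ha ha_even ha_pos
  rw [hu, List.dropLast_concat] at h
  rw [hu, h, List.cons_append]

/-- The full word has `k` letters `U` and `n - k` letters `R`. The snake word lacks one of each, and
a word with `u` letters `U` spans `u + 1` rows (likewise for columns), so `λ` fits in the `k × (n -
k)` rectangle. -/
theorem outerShape_snakeWord_bounded {a : List ℕ} (ha : a ≠ []) (ha_even : Even a.length)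
    (ha_pos : ∀ x ∈ a, 0 < x) :
    evenSum a ≤ a.sum ∧ ∀ c ∈ outerShape (snakeWord a),
      c.1 < evenSum a ∧ c.2 < a.sum - evenSum a := by
  have h := count_fullWord a ha_even
  rw [fullWord_eq ha ha_even ha_pos] at h
  simp at h
  refine ⟨by omega, fun c hc => ?_⟩
  have := mem_outerShape_le hc
  omega

end QSnake

theorem theorem3p2p1 (a : List ℕ) (ha : a ≠ []) (ha_even : Even a.length) (ha_pos : ∀ x ∈ a, 0 < x)
    (r s : ℕ) (hrs : (r : ℚ) / (s : ℚ) = QSnake.contFracValue a)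
    (R S : Polynomial ℤ) (hcop : IsRelPrime R S) (hS : 0 < S.leadingCoeff)
    (hRS : QSnake.qRational a =
      algebraMap (Polynomial ℤ) (RatFunc ℤ) R / algebraMap (Polynomial ℤ) (RatFunc ℤ) S)
    (μ Λ : YoungDiagram) (hμ : μ = QSnake.innerShape (QSnake.snakeWord a))
    (hΛ : Λ = QSnake.outerShape (QSnake.snakeWord a))
    (n k : ℕ) (hn : n = a.sum) (hk : k = QSnake.evenSum a)
    (K : Type*) [Field K] [Fintype K] (q : ℕ) (hq : q = Fintype.card K) :
    (q : ℤ) ^ μ.card * R.eval (q : ℤ) =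
      ((⋃ ν ∈ Set.Icc μ Λ, QSnake.openSchubertCell K k n ν).ncard : ℤ) := by
  subst hμ hΛ hn hk hq
  obtain ⟨hkn, hb⟩ := QSnake.outerShape_snakeWord_bounded ha ha_even ha_pos
  rw [QSnake.ncard_iUnion_openSchubertCell K hkn _ _ hb,
    QSnake.numerator_eq ha ha_even ha_pos hcop hS hRS, QSnake.eval_numerator,
    ← QSnake.sum_Icc_innerShape_outerShape]
  push_cast
  rfl
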